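/- Let $G$ be a unital inverse semigroup with unit $e$ (a monoid in which every $s$ has exactly one $s^*$ with $ss^*s=s$ and $s^*ss^*=s^*$), and let $\mathcal A$ be a (not necessarily unital) $C^*$-algebra. A partial action $\beta$ of $G$ on $\mathcal A$ consists of closed two-sided ideals $E_s$ of $\mathcal A$ ($s\in G$), with $E_e=\mathcal A$, and of $*$-isomorphisms $\beta_s:E_{s^*}\to E_s$ such that for all $s,t\in G$: (i) $\beta_s^{-1}=\beta_{s^*}$; (ii) $\beta_s(E_{s^*}\cap E_t)=E_s\cap E_{st}$; (iii) $\beta_s(\beta_t(x))=\beta_{st}(x)$ for all $x\in E_{t^*}\cap E_{t^*s^*}$. A covariant representation of $\beta$ is a triple $(\pi,\nu,\mathcal H)$, where $\pi$ is a non-degenerate $*$-representation of $\mathcal A$ on a Hilbert space $\mathcal H$ and, for each $s\in G$, $\nu_s$ is a partial isometry on $\mathcal H$ with initial space $\pi(E_{s^*})\mathcal H$ and final space $\pi(E_s)\mathcal H$, such that for all $s,t\in G$: (1) $\nu_s\pi(a)\nu_{s^*}=\pi(\beta_s(a))$ for $a\in E_{s^*}$; (2) $\nu_{st}h=\nu_s\nu_th$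 for $h\in\pi(E_{t^*}E_{t^*s^*})\mathcal H$; (3) $\nu_{s^*}=\nu_s^*$. Let $L=\{x\in\ell^1(G,\mathcal A): x(g)\in E_g \text{ for all } g\in G\}$, with the product and involution $$(x*y)(g)=\sum_{hk=g}\beta_h\bigl(\beta_{h^*}(x(h))\,y(k)\bigr),\qquad x^*(g)=\beta_g\bigl(x(g^*)^*\bigr).$$ For $x\in L$ put $(\pi\times\nu)(x)=\sum_{s\in G}\pi(x(s))\nu_s$ and $\|x\|_1=\sup\|(\pi\times\nu)(x)\|$, the supremum being taken over all covariant representations $(\pi,\nu,\mathcal H)$ of $\beta$, and let $N=\{x\in L:\|x\|_1=0\}$. The crossed product $\mathcal A\ltimes_\beta G$ is the $C^*$-algebra obtained by completing $L/N$ with respect to $\|\cdot\|_1$. If $G$ is a semilattice, that is, if every element of $G$ is idempotent, then for every partial action $\beta$ of $G$ on $\mathcal A$ the $C^*$-algebras $\mathcal A\ltimes_\beta G$ and $\mathcal A$ are $*$-isomorphic. -/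

import Mathlib

open Topology UniformSpace
open scoped Pointwise

namespace PartialCrossedProduct

universe u v

/-! ### Unital inverse semigroups -/

/-- A unital inverse semigroup: a monoid in which every `s` has exactly one `t` with
`s * t * s = s` and `t * s * t = t`. This element `t`, usually written `s^*`, is denoted `s⁻¹`. -/
class UnitalInverseSemigroup (G : Type v) extends Monoid G, Inv G where
  mul_inv_mul : ∀ s : G, s * s⁻¹ * s = s
  inv_mul_inv : ∀ s : G, s⁻¹ * s * s⁻¹ = s⁻¹
  inv_unique : ∀ s t : G, s * t * s = s → t * s * t = t → t = s⁻¹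

/-- An inverse semigroup is a semilattice if all of its elements are idempotent. -/
def IsSemilattice (G : Type v) [UnitalInverseSemigroup G] : Prop :=
  ∀ s : G, s * s = s

namespace UnitalInverseSemigroup

variable {G : Type v} [UnitalInverseSemigroup G]

theorem inv_inv' (s : G) : s⁻¹⁻¹ = s :=
  (inv_unique s⁻¹ s (inv_mul_inv s) (mul_inv_mul s)).symm

theorem inv_of_idem {e : G} (he : e * e = e) : e⁻¹ = e :=
  (inv_unique e e (by rw [he, he]) (by rw [he, he])).symm

theorem idem_mul_idem {e f : G} (he : e * e = e) (hf : f * f = f) :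
    (e * f) * (e * f) = e * f := by
  set x := (e * f)⁻¹ with hx
  have h1 : (e * f) * x * (e * f) = e * f := mul_inv_mul _
  have h2 : x * (e * f) * x = x := inv_mul_inv _
  have h3 : (f * x * e) * (f * x * e) = f * x * e := by
    calc (f * x * e) * (f * x * e) = f * (x * (e * f) * x) * e := by simp only [mul_assoc]
      _ = f * x * e := by rw [h2]
  have h4 : (e * f) * (f * x * e) * (e * f) = e * f := by
    calc (e * f) * (f * x * e) * (e * f) = e * (f * f) * x * (e * e) * f := by
          simp only [mul_assoc]
      _ = (e * f) * x * (e * f) := by rw [he, hf]; simp only [mul_assoc]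
      _ = e * f := h1
  have h5 : (f * x * e) * (e * f) * (f * x * e) = f * x * e := by
    calc (f * x * e) * (e * f) * (f * x * e) = f * x * (e * e) * (f * f) * x * e := by
          simp only [mul_assoc]
      _ = (f * x * e) * (f * x * e) := by rw [he, hf]; simp only [mul_assoc]
      _ = f * x * e := h3
  have h6 : e * f = f * x * e := (inv_unique _ _ h5 h4).trans (inv_of_idem h3)
  rw [h6]; exact h3

theorem idem_comm {e f : G} (he : e * e = e) (hf : f * f = f) : e * f = f * e := by
  have h1 := idem_mul_idem he hf
  have h2 := idem_mul_idem hf he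
  have h3 : f * e = (e * f)⁻¹ := by
    refine inv_unique _ _ ?_ ?_
    · calc (e * f) * (f * e) * (e * f) = e * (f * f) * (e * e) * f := by simp only [mul_assoc]
        _ = (e * f) * (e * f) := by rw [he, hf]; simp only [mul_assoc]
        _ = e * f := h1
    · calc (f * e) * (e * f) * (f * e) = f * (e * e) * (f * f) * e := by simp only [mul_assoc]
        _ = (f * e) * (f * e) := by rw [he, hf]; simp only [mul_assoc]
        _ = f * e := h2
  rw [h3, inv_of_idem h1]

theorem mul_inv_rev' (s t : G) : (s * t)⁻¹ = t⁻¹ * s⁻¹ := by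
  have e1 : (t * t⁻¹) * (t * t⁻¹) = t * t⁻¹ := by rw [← mul_assoc, mul_inv_mul]
  have e2 : (s⁻¹ * s) * (s⁻¹ * s) = s⁻¹ * s := by rw [← mul_assoc, inv_mul_inv]
  have hc := idem_comm e1 e2
  refine (inv_unique _ _ ?_ ?_).symm
  · calc s * t * (t⁻¹ * s⁻¹) * (s * t) = s * ((t * t⁻¹) * (s⁻¹ * s)) * t := by
          simp only [mul_assoc]
      _ = (s * s⁻¹ * s) * (t * t⁻¹ * t) := by rw [hc]; simp only [mul_assoc]
      _ = s * t := by rw [mul_inv_mul, mul_inv_mul]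
  · calc t⁻¹ * s⁻¹ * (s * t) * (t⁻¹ * s⁻¹) = t⁻¹ * ((s⁻¹ * s) * (t * t⁻¹)) * s⁻¹ := by
          simp only [mul_assoc]
      _ = (t⁻¹ * t * t⁻¹) * (s⁻¹ * s * s⁻¹) := by rw [← hc]; simp only [mul_assoc]
      _ = t⁻¹ * s⁻¹ := by rw [inv_mul_inv, inv_mul_inv]

end UnitalInverseSemigroup

open UnitalInverseSemigroup

/-! ### Partial actions on C⋆-algebras -/

/-- A partial action of a unital inverse semigroup `G` on a C⋆-algebra `A`. Each `D s` is a
closed two-sided ideal of `A`, with `D 1 = A`, and `act s` is a partial bijection of `A` that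
restricts to an isomorphism of C⋆-algebras `D s⁻¹ → D s`. -/
structure PartialAction (G : Type v) (A : Type u) [UnitalInverseSemigroup G]
    [NonUnitalCStarAlgebra A] where
  D : G → Submodule ℂ A
  mul_mem_left : ∀ (s : G) (a : A) {x : A}, x ∈ D s → a * x ∈ D s
  mul_mem_right : ∀ (s : G) (a : A) {x : A}, x ∈ D s → x * a ∈ D s
  isClosed_D : ∀ s : G, IsClosed (D s : Set A)
  D_one : D 1 = ⊤
  act : G → PartialEquiv A A
  source_act : ∀ s : G, (act s).source = D s⁻¹
  target_act : ∀ s : G, (act s).target = D s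
  map_add : ∀ (s : G) {x y : A}, x ∈ D s⁻¹ → y ∈ D s⁻¹ → act s (x + y) = act s x + act s y
  map_smul : ∀ (s : G) (c : ℂ) {x : A}, x ∈ D s⁻¹ → act s (c • x) = c • act s x
  map_mul : ∀ (s : G) {x y : A}, x ∈ D s⁻¹ → y ∈ D s⁻¹ → act s (x * y) = act s x * act s y
  map_star : ∀ (s : G) {x : A}, x ∈ D s⁻¹ → act s (star x) = star (act s x)
  symm_act : ∀ (s : G) {x : A}, x ∈ D s → (act s).symm x = act s⁻¹ x
  image_act : ∀ s t : G,
    act s '' ((D s⁻¹ : Set A) ∩ (D t : Set A)) = (D s : Set A) ∩ (D (s * t) : Set A)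
  act_act : ∀ (s t : G) {x : A}, x ∈ D t⁻¹ → x ∈ D (t⁻¹ * s⁻¹) →
    act s (act t x) = act (s * t) x

section CStar

variable {A : Type u} [NonUnitalCStarAlgebra A]

/-- For each `x` there is a sequence `e n` of self-adjoint elements, lying in every ideal
containing `x`, with `x * e n → x`. -/
theorem exists_approx (x : A) : ∃ e : ℕ → A, (∀ n, star (e n) = e n) ∧
    (∀ I : Submodule ℂ A, (∀ a : A, ∀ y ∈ I, a * y ∈ I) → (∀ a : A, ∀ y ∈ I, y * a ∈ I) →
      x ∈ I → ∀ n, e n ∈ I) ∧ Filter.Tendsto (fun n => x * e n) Filter.atTop (𝓝 x) := by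
  set y : A := star x * x with hy
  have hys : IsSelfAdjoint y := IsSelfAdjoint.star_mul_self x
  let k : ℕ → ℝ → ℝ := fun n t => ((n : ℝ) + 1) ^ 2 * t / (1 + ((n : ℝ) + 1) ^ 2 * t ^ 2)
  let f : ℕ → ℝ → ℝ := fun n t => t * k n t
  have hpos : ∀ (n : ℕ) (t : ℝ), 0 < 1 + ((n : ℝ) + 1) ^ 2 * t ^ 2 := fun n t => by positivity
  have hk : ∀ n, Continuous (k n) := fun n =>
    Continuous.div (by fun_prop) (by fun_prop) fun t => (hpos n t).ne'
  have hf : ∀ n, Continuous (f n) := fun n => continuous_id.mul (hk n)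
  have hk0 : ∀ n, k n 0 = 0 := fun n => by simp [k]
  have hf0 : ∀ n, f n 0 = 0 := fun n => by simp [f]
  have hsa : ∀ n, star (cfcₙ (f n) y) = cfcₙ (f n) y := fun n => (cfcₙ_predicate (f n) y).star_eq
  have hfac : ∀ n, cfcₙ (f n) y = y * cfcₙ (k n) y := fun n => by
    have := cfcₙ_mul (R := ℝ) (fun t => t) (k n) y (by fun_prop) rfl (hk n).continuousOn (hk0 n)
    rw [cfcₙ_id' ℝ y] at this
    exact this
  refine ⟨fun n => cfcₙ (f n) y, hsa, ?_, ?_⟩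
  · intro I hl hr hx n
    show cfcₙ (f n) y ∈ I
    rw [hfac]
    exact hr _ _ (hl _ _ hx)
  · have hbound : ∀ n : ℕ, ‖x * cfcₙ (f n) y - x‖ ^ 2 ≤ 1 / ((n : ℝ) + 1) := by
      intro n
      set e := cfcₙ (f n) y with he
      have h1 : star (x * e - x) * (x * e - x) = cfcₙ (fun t => t * (1 - f n t) ^ 2) y := by
        have h2 : star (x * e - x) * (x * e - x) = (e * y) * e - e * y - y * e + y := by
          rw [star_sub, star_mul, hsa, hy]; noncomm_ring
        have c1 : e * y = cfcₙ (fun t => f n t * t) y := by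
          rw [cfcₙ_mul (f n) (fun t => t) y (hf n).continuousOn (hf0 n), cfcₙ_id' ℝ y]
        have c2 : y * e = cfcₙ (fun t => t * f n t) y := by
          rw [cfcₙ_mul (fun t => t) (f n) y (by fun_prop) rfl (hf n).continuousOn (hf0 n),
            cfcₙ_id' ℝ y]
        have c3 : (e * y) * e = cfcₙ (fun t => f n t * t * f n t) y := by
          rw [c1, cfcₙ_mul (fun t => f n t * t) (f n) y ((hf n).mul continuous_id).continuousOn
            (by simp [hf0]) (hf n).continuousOn (hf0 n)]
        have hfn := hf n
        have c4 : (e * y) * e - e * y = cfcₙ (fun t => f n t * t * f n t - f n t * t) y := by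
          rw [c3, c1, cfcₙ_sub (fun t => f n t * t * f n t) (fun t => f n t * t) y
            (by fun_prop) (by simp [hf0]) (by fun_prop) (by simp [hf0])]
        have c5 : (e * y) * e - e * y - y * e
            = cfcₙ (fun t => f n t * t * f n t - f n t * t - t * f n t) y := by
          rw [c4, c2, cfcₙ_sub (fun t => f n t * t * f n t - f n t * t) (fun t => t * f n t) y
            (by fun_prop) (by simp [hf0]) (by fun_prop) (by simp [hf0])]
        rw [h2, c5]
        nth_rewrite 2 [← cfcₙ_id' ℝ y]
        rw [← cfcₙ_add (fun t => f n t * t * f n t - f n t * t - t * f n t) (fun t => t) y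
          (by fun_prop) (by simp [hf0]) (by fun_prop) rfl]
        congr 1
        funext t; ring
      rw [sq, ← CStarRing.norm_star_mul_self, h1]
      refine norm_cfcₙ_le fun t _ => ?_
      have hn : (0 : ℝ) < (n : ℝ) + 1 := by positivity
      have h3 : 1 - f n t = 1 / (1 + ((n : ℝ) + 1) ^ 2 * t ^ 2) := by
        have := (hpos n t).ne'
        simp only [f, k]
        field_simp
        ring
      rw [h3, Real.norm_eq_abs, abs_mul, abs_of_nonneg
        (show (0 : ℝ) ≤ (1 / (1 + ((n : ℝ) + 1) ^ 2 * t ^ 2)) ^ 2 by positivity), div_pow, one_pow,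
        mul_one_div, div_le_div_iff₀ (by have := hpos n t; positivity) hn, one_mul]
      have h4 : |t| * ((n : ℝ) + 1) ≤ 1 + ((n : ℝ) + 1) ^ 2 * t ^ 2 := by
        rw [← sq_abs t]
        nlinarith [sq_nonneg (|t| * ((n : ℝ) + 1) - 1), sq_nonneg (|t| * ((n : ℝ) + 1)),
          abs_nonneg t]
      nlinarith [h4, sq_nonneg (((n : ℝ) + 1) * t)]
    rw [tendsto_iff_norm_sub_tendsto_zero]
    have h5 : Filter.Tendsto (fun n => ‖x * cfcₙ (f n) y - x‖ ^ 2) Filter.atTop (𝓝 0) :=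
      squeeze_zero (fun n => by positivity) hbound tendsto_one_div_add_atTop_nhds_zero_nat
    have h6 := h5.sqrt
    simpa [Real.sqrt_sq (norm_nonneg _)] using h6

end CStar

namespace PartialAction

variable {G : Type v} {A : Type u} [UnitalInverseSemigroup G] [NonUnitalCStarAlgebra A]
variable (α : PartialAction G A)

theorem star_mem {s : G} {x : A} (hx : x ∈ α.D s) : star x ∈ α.D s := by
  obtain ⟨e, he, hI, ht⟩ := exists_approx x
  have h := hI (α.D s) (fun a _ hy => α.mul_mem_left s a hy)
    (fun a _ hy => α.mul_mem_right s a hy) hx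
  refine (α.isClosed_D s).mem_of_tendsto ht.star (Filter.Eventually.of_forall fun n => ?_)
  rw [star_mul, he]
  exact α.mul_mem_right s _ (h n)

theorem act_mem {s : G} {x : A} (hx : x ∈ α.D s⁻¹) : α.act s x ∈ α.D s := by
  have h := (α.act s).map_source (x := x) (by rw [α.source_act]; exact hx)
  rwa [α.target_act] at h

theorem act_inv_mem {s : G} {x : A} (hx : x ∈ α.D s) : α.act s⁻¹ x ∈ α.D s⁻¹ :=
  α.act_mem (by rwa [inv_inv'])

theorem act_act_inv {s : G} {x : A} (hx : x ∈ α.D s) : α.act s (α.act s⁻¹ x) = x := by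
  rw [← α.symm_act s hx]
  exact (α.act s).right_inv (by rw [α.target_act]; exact hx)

/-- The ideal `D s` as a C⋆-subalgebra. -/
def idealAlg (s : G) : NonUnitalStarSubalgebra ℂ A where
  carrier := α.D s
  add_mem' := (α.D s).add_mem
  zero_mem' := (α.D s).zero_mem
  mul_mem' := fun {_ _} _ hb => α.mul_mem_left s _ hb
  smul_mem' := fun c _ hx => (α.D s).smul_mem c hx
  star_mem' := fun hx => α.star_mem hx

theorem norm_act_le {s : G} {x : A} (hx : x ∈ α.D s⁻¹) : ‖α.act s x‖ ≤ ‖x‖ := by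
  have : IsClosed ((α.idealAlg s⁻¹ : NonUnitalStarSubalgebra ℂ A) : Set A) := α.isClosed_D s⁻¹
  let φ : (α.idealAlg s⁻¹) →⋆ₙₐ[ℂ] A :=
    { toFun := fun x => α.act s x
      map_smul' := fun c x => α.map_smul s c x.2
      map_zero' := by
        have := α.map_smul s 0 (x := 0) (α.D s⁻¹).zero_mem
        simpa using this
      map_add' := fun x y => α.map_add s x.2 y.2
      map_mul' := fun x y => α.map_mul s x.2 y.2
      map_star' := fun x => α.map_star s x.2 }
  exact NonUnitalStarAlgHom.norm_apply_le φ ⟨x, hx⟩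

/-! ### The convolution algebra -/

/-- The space `L` of all `x ∈ ℓ¹(G, A)` with `x g ∈ D g` for all `g`. -/
def L : Submodule ℂ (G → A) where
  carrier := {x | (∀ g, x g ∈ α.D g) ∧ Summable fun g => ‖x g‖}
  zero_mem' := ⟨fun g => (α.D g).zero_mem, by simp⟩
  add_mem' := fun {x y} hx hy => ⟨fun g => (α.D g).add_mem (hx.1 g) (hy.1 g),
    Summable.of_nonneg_of_le (fun _ => norm_nonneg _) (fun _ => norm_add_le _ _) (hx.2.add hy.2)⟩
  smul_mem' := fun c x hx => ⟨fun g => (α.D g).smul_mem c (hx.1 g), by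
    simpa [norm_smul] using hx.2.mul_left ‖c‖⟩

/-- The summand `β_h (β_{h^*}(x h) (y k))` of the convolution product. -/
def term (x y : G → A) (p : G × G) : A := α.act p.1 (α.act p.1⁻¹ (x p.1) * y p.2)

variable {α}

theorem arg_mem {h : G} {a : A} (ha : a ∈ α.D h) (b : A) : α.act h⁻¹ a * b ∈ α.D h⁻¹ :=
  α.mul_mem_right _ _ (α.act_inv_mem ha)

theorem act_arg_mem {h k : G} {a b : A} (ha : a ∈ α.D h) (hb : b ∈ α.D k) :
    α.act h (α.act h⁻¹ a * b) ∈ (α.D h : Set A) ∩ (α.D (h * k) : Set A) := by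
  rw [← α.image_act]
  exact ⟨_, ⟨arg_mem ha b, α.mul_mem_left _ _ hb⟩, rfl⟩

theorem norm_act_arg_le {h : G} {a : A} (ha : a ∈ α.D h) (b : A) :
    ‖α.act h (α.act h⁻¹ a * b)‖ ≤ ‖a‖ * ‖b‖ := by
  refine (α.norm_act_le (arg_mem ha b)).trans ((norm_mul_le _ _).trans ?_)
  gcongr
  exact α.norm_act_le (by rwa [inv_inv'])

theorem norm_term_le (x y : α.L) (p : G × G) : ‖α.term x y p‖ ≤ ‖x.1 p.1‖ * ‖y.1 p.2‖ :=
  norm_act_arg_le (x.2.1 p.1) _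

theorem term_mem (x y : α.L) (p : G × G) : α.term x y p ∈ α.D (p.1 * p.2) :=
  (act_arg_mem (x.2.1 p.1) (y.2.1 p.2)).2

theorem term_mem_left (x y : α.L) (p : G × G) : α.term x y p ∈ α.D p.1 :=
  (act_arg_mem (x.2.1 p.1) (y.2.1 p.2)).1

theorem summable_norm_term (x y : α.L) : Summable fun p : G × G => ‖α.term x y p‖ :=
  Summable.of_nonneg_of_le (fun _ => norm_nonneg _) (norm_term_le x y)
    (Summable.mul_of_nonneg x.2.2 y.2.2 (fun _ => norm_nonneg _) fun _ => norm_nonneg _)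

theorem summable_norm_sigma (x y : α.L) :
    Summable fun q : (Σ g : G, {p : G × G // p.1 * p.2 = g}) => ‖α.term x y q.2.1‖ :=
  (Equiv.sigmaFiberEquiv fun p : G × G => p.1 * p.2).summable_iff.mpr (summable_norm_term x y)

/-- The convolution product
`(x * y)(g) = ∑_{hk = g} β_h (β_{h^*}(x h) (y k))` on `L`. -/
noncomputable instance : Mul α.L where
  mul x y := ⟨fun g => ∑' p : {p : G × G // p.1 * p.2 = g},
      α.act p.1.1 (α.act p.1.1⁻¹ (x.1 p.1.1) * y.1 p.1.2), by
    constructor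
    · intro g
      have hs : Summable fun p : {p : G × G // p.1 * p.2 = g} => α.term x y p.1 :=
        ((summable_norm_sigma x y).sigma_factor g).of_norm
      refine (α.isClosed_D g).mem_of_tendsto hs.hasSum (Filter.Eventually.of_forall fun F => ?_)
      exact (α.D g).sum_mem fun p _ => by
        have h := term_mem x y p.1
        rwa [p.2] at h
    · refine Summable.of_nonneg_of_le (fun _ => norm_nonneg _) (fun g => ?_)
        (summable_norm_sigma x y).sigma
      exact norm_tsum_le_tsum_norm ((summable_norm_sigma x y).sigma_factor g)⟩

/-- The involution `x^*(g) = β_g (x(g^*)^*)` on `L`. -/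
instance : Star α.L where
  star x := ⟨fun g => α.act g (star (x.1 g⁻¹)),
    fun g => α.act_mem (α.star_mem (x.2.1 g⁻¹)), by
    have hi : Function.Injective fun g : G => g⁻¹ := fun a b h => by
      rw [← inv_inv' a, ← inv_inv' b]; exact congrArg _ h
    refine Summable.of_nonneg_of_le (fun _ => norm_nonneg _) (fun g => ?_)
      (x.2.2.comp_injective hi)
    exact (α.norm_act_le (α.star_mem (x.2.1 g⁻¹))).trans (norm_star _).le⟩

theorem mul_apply (x y : α.L) (g : G) :
    (x * y).1 g = ∑' p : {p : G × G // p.1 * p.2 = g}, α.term x y p.1 := rfl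

theorem star_apply (x : α.L) (g : G) : (star x).1 g = α.act g (star (x.1 g⁻¹)) := rfl

end PartialAction

/-! ### Covariant representations -/

section Hilbert

variable {A : Type u} [NonUnitalCStarAlgebra A]
variable {H : Type*} [NormedAddCommGroup H] [InnerProductSpace ℂ H] [CompleteSpace H]

/-- The closed linear span of all `π a h` with `a ∈ I` and `h ∈ H`. If `I` is a closed ideal,
then by the Cohen-Hewitt factorization theorem this is the set `π(I)H` of all such vectors. -/
def closedSpan (π : A →⋆ₙₐ[ℂ] (H →L[ℂ] H)) (I : Set A) : Submodule ℂ H :=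
  (Submodule.span ℂ {k : H | ∃ a ∈ I, ∃ h : H, k = π a h}).topologicalClosure

/-- `u` is a partial isometry with initial space `M` and final space `N`. -/
def IsPartialIsometryBetween (u : H →L[ℂ] H) (M N : Submodule ℂ H) : Prop :=
  (∀ h ∈ M, ‖u h‖ = ‖h‖) ∧ (∀ h ∈ Mᗮ, u h = 0) ∧ Set.range u = (N : Set H)

end Hilbert

/-- A covariant representation of the partial action `α`. Condition `mul_u` concerns the products
`D t⁻¹ D (t⁻¹s⁻¹)`. The Hilbert spaces live in a universe large enough for `A` and `G`. -/
structure CovariantRep {G : Type v} {A : Type u} [UnitalInverseSemigroup G]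
    [NonUnitalCStarAlgebra A] (α : PartialAction G A) where
  H : Type (max u v)
  [normed : NormedAddCommGroup H]
  [inner : InnerProductSpace ℂ H]
  [complete : CompleteSpace H]
  π : A →⋆ₙₐ[ℂ] (H →L[ℂ] H)
  nondegenerate : closedSpan π Set.univ = ⊤
  u : G → (H →L[ℂ] H)
  isPartialIsometry : ∀ g : G,
    IsPartialIsometryBetween (u g) (closedSpan π (α.D g⁻¹)) (closedSpan π (α.D g))
  covariance : ∀ (g : G) (a : A), a ∈ α.D g⁻¹ → u g * π a * u g⁻¹ = π (α.act g a)
  mul_u : ∀ s t : G, ∀ h ∈ closedSpan π ((α.D t⁻¹ : Set A) * (α.D (t⁻¹ * s⁻¹) : Set A)),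
    u (s * t) h = u s (u t h)
  inv_u : ∀ s : G, u s⁻¹ = ContinuousLinearMap.adjoint (u s)

attribute [instance] CovariantRep.normed CovariantRep.inner CovariantRep.complete

section Hilbert

variable {A : Type u} [NonUnitalCStarAlgebra A]
variable {H : Type*} [NormedAddCommGroup H] [InnerProductSpace ℂ H] [CompleteSpace H]

theorem mem_closedSpan (π : A →⋆ₙₐ[ℂ] (H →L[ℂ] H)) {I : Set A} {a : A} (ha : a ∈ I) (h : H) :
    π a h ∈ closedSpan π I :=
  Submodule.le_topologicalClosure _ (Submodule.subset_span ⟨a, ha, h, rfl⟩)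

theorem closedSpan_hasProj (π : A →⋆ₙₐ[ℂ] (H →L[ℂ] H)) (I : Set A) :
    (closedSpan π I).HasOrthogonalProjection := by
  have : CompleteSpace (closedSpan π I) :=
    (Submodule.isClosed_topologicalClosure _).completeSpace_coe
  infer_instance

theorem IsPartialIsometryBetween.norm_le {H : Type*} [NormedAddCommGroup H]
    [InnerProductSpace ℂ H] {u : H →L[ℂ] H} {M N : Submodule ℂ H}
    [M.HasOrthogonalProjection] (hu : IsPartialIsometryBetween u M N) : ‖u‖ ≤ 1 := by
  refine u.opNorm_le_bound zero_le_one fun h => ?_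
  obtain ⟨m, hm, n, hn, rfl⟩ := M.exists_add_mem_mem_orthogonal h
  rw [_root_.map_add, hu.2.1 n hn, add_zero, hu.1 m hm, one_mul]
  have h0 : inner ℂ m n = 0 := Submodule.inner_right_of_mem_orthogonal hm hn
  have h1 := norm_add_sq_eq_norm_sq_add_norm_sq_of_inner_eq_zero m n h0
  nlinarith [norm_nonneg m, norm_nonneg n, norm_nonneg (m + n)]

theorem IsPartialIsometryBetween.adjoint_apply {u : H →L[ℂ] H} {M N : Submodule ℂ H}
    [M.HasOrthogonalProjection] (hu : IsPartialIsometryBetween u M N) {h : H} (hh : h ∈ M) :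
    ContinuousLinearMap.adjoint u (u h) = h := by
  let φ : M →ₗᵢ[ℂ] H :=
    { toLinearMap := (u : H →ₗ[ℂ] H).comp M.subtype
      norm_map' := fun x => hu.1 x x.2 }
  refine ext_inner_right ℂ fun k => ?_
  obtain ⟨m, hm, n, hn, rfl⟩ := M.exists_add_mem_mem_orthogonal k
  rw [ContinuousLinearMap.adjoint_inner_left, _root_.map_add, hu.2.1 n hn, add_zero,
    inner_add_right, Submodule.inner_right_of_mem_orthogonal hh hn, add_zero]
  exact φ.inner_map_map ⟨h, hh⟩ ⟨m, hm⟩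

end Hilbert

namespace CovariantRep

variable {G : Type v} {A : Type u} [UnitalInverseSemigroup G] [NonUnitalCStarAlgebra A]
variable {α : PartialAction G A} (r : CovariantRep α)

/-- The integrated form `π × u`, that is `x ↦ ∑_s π(x s) u_s` on `L`. -/
noncomputable def integrated (x : α.L) : r.H →L[ℂ] r.H :=
  ∑' s : G, r.π (x.1 s) * r.u s

theorem norm_u_le (s : G) : ‖r.u s‖ ≤ 1 :=
  have := closedSpan_hasProj r.π (α.D s⁻¹ : Set A)
  (r.isPartialIsometry s).norm_le

theorem star_u (s : G) : star (r.u s) = r.u s⁻¹ := (r.inv_u s).symm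

theorem norm_summand_le (x : G → A) (s : G) : ‖r.π (x s) * r.u s‖ ≤ ‖x s‖ :=
  calc ‖r.π (x s) * r.u s‖ ≤ ‖r.π (x s)‖ * ‖r.u s‖ := norm_mul_le _ _
    _ ≤ ‖x s‖ * 1 := by
      gcongr
      · exact NonUnitalStarAlgHom.norm_apply_le r.π _
      · exact r.norm_u_le s
    _ = ‖x s‖ := mul_one _

theorem summable_norm (x : α.L) : Summable fun s => ‖r.π (x.1 s) * r.u s‖ :=
  Summable.of_nonneg_of_le (fun _ => norm_nonneg _) (r.norm_summand_le x.1) x.2.2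

theorem norm_integrated_le (x : α.L) : ‖r.integrated x‖ ≤ ∑' s, ‖x.1 s‖ :=
  (norm_tsum_le_tsum_norm (r.summable_norm x)).trans
    ((r.summable_norm x).tsum_le_tsum (r.norm_summand_le x.1) x.2.2)

theorem integrated_add (x y : α.L) :
    r.integrated (x + y) = r.integrated x + r.integrated y := by
  unfold integrated
  rw [← (r.summable_norm x).of_norm.tsum_add (r.summable_norm y).of_norm]
  congr 1; funext s
  show r.π (x.1 s + y.1 s) * r.u s = _
  rw [map_add, add_mul]

theorem integrated_smul (c : ℂ) (x : α.L) : r.integrated (c • x) = c • r.integrated x := by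
  unfold integrated
  rw [← (r.summable_norm x).of_norm.tsum_const_smul c]
  congr 1; funext s
  show r.π (c • x.1 s) * r.u s = _
  rw [map_smul, smul_mul_assoc]

theorem u_u_inv_π {s : G} {a : A} (ha : a ∈ α.D s) : r.u s * r.u s⁻¹ * r.π a = r.π a := by
  ext h
  have := closedSpan_hasProj r.π (α.D s⁻¹⁻¹ : Set A)
  have h1 : r.π a h ∈ closedSpan r.π (α.D s⁻¹⁻¹ : Set A) :=
    mem_closedSpan r.π (by rwa [inv_inv']) h
  have h2 := (r.isPartialIsometry s⁻¹).adjoint_apply h1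
  rw [← r.inv_u, inv_inv'] at h2
  exact h2

theorem π_u_u_inv {s : G} {a : A} (ha : a ∈ α.D s) : r.π a * (r.u s * r.u s⁻¹) = r.π a := by
  have h := congrArg star (r.u_u_inv_π (α.star_mem ha))
  rwa [star_mul, star_mul, star_u, star_u, inv_inv', map_star, star_star] at h

theorem π_u_mul_u {s t : G} {a : A} (h1 : a ∈ α.D s) (h2 : a ∈ α.D (s * t)) :
    r.π a * (r.u s * r.u t) = r.π a * r.u (s * t) := by
  have key : ∀ b c : A, b ∈ α.D s → c ∈ α.D (s * t) →
      r.u t⁻¹ * (r.u s⁻¹ * r.π (b * c)) = r.u (t⁻¹ * s⁻¹) * r.π (b * c) := by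
    intro b c hb hc
    ext h
    refine (r.mul_u t⁻¹ s⁻¹ _ (mem_closedSpan r.π ?_ h)).symm
    rw [inv_inv', inv_inv']
    exact Set.mul_mem_mul hb hc
  have key2 : r.u t⁻¹ * (r.u s⁻¹ * r.π (star a)) = r.u (t⁻¹ * s⁻¹) * r.π (star a) := by
    obtain ⟨e, -, hI, ht⟩ := exists_approx (star a)
    have hc : Continuous r.π := by
      exact AddMonoidHomClass.continuous_of_bound r.π 1 (by
        simpa only [one_mul] using NonUnitalStarAlgHom.norm_apply_le r.π)
    have hl : Filter.Tendsto (fun n => r.π (star a * e n)) Filter.atTop (𝓝 (r.π (star a))) :=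
      (hc.tendsto _).comp ht
    have l1 := (hl.const_mul (r.u s⁻¹)).const_mul (r.u t⁻¹)
    have l2 := hl.const_mul (r.u (t⁻¹ * s⁻¹))
    refine tendsto_nhds_unique l1 (l2.congr fun n => (key _ _ (α.star_mem h1) ?_).symm)
    exact hI _ (fun b _ hy => α.mul_mem_left _ b hy) (fun b _ hy => α.mul_mem_right _ b hy)
      (α.star_mem h2) n
  have h := congrArg star key2
  simp only [star_mul, star_u, inv_inv', mul_inv_rev', map_star, star_star] at h
  rw [← mul_assoc]; exact h

theorem integrated_term (x y : α.L) (p : G × G) :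
    (r.π (x.1 p.1) * r.u p.1) * (r.π (y.1 p.2) * r.u p.2)
      = r.π (α.term x y p) * r.u (p.1 * p.2) := by
  obtain ⟨s, t⟩ := p
  have ha := x.2.1 s
  set a := x.1 s
  set b := y.1 t
  set c := α.act s⁻¹ a with hc
  have hcm : c ∈ α.D s⁻¹ := α.act_inv_mem ha
  have e1 : r.u s * r.π c * r.u s⁻¹ = r.π a := by
    rw [r.covariance s c hcm, hc, α.act_act_inv ha]
  have e2 : r.u s⁻¹ * r.u s * r.π c = r.π c := by
    have := r.u_u_inv_π hcm
    rwa [inv_inv'] at this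
  have e3 : r.π a * r.u s = r.u s * r.π c := by
    have e4 : r.π c * (r.u s⁻¹ * r.u s) = r.π c := by
      have := r.π_u_u_inv hcm
      rwa [inv_inv'] at this
    rw [← e1, mul_assoc, mul_assoc, e4]
  have hcb : c * b ∈ α.D s⁻¹ := α.mul_mem_right _ _ hcm
  have e5 : r.π (c * b) = r.π (c * b) * (r.u s⁻¹ * r.u s) := by
    have := r.π_u_u_inv hcb
    rw [inv_inv'] at this
    exact this.symm
  have h1 := PartialAction.term_mem_left x y (s, t)
  have h2 := PartialAction.term_mem x y (s, t)
  calc r.π a * r.u s * (r.π b * r.u t) = r.u s * (r.π c * r.π b) * r.u t := by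
        rw [e3]; simp only [mul_assoc]
    _ = r.u s * (r.π (c * b) * (r.u s⁻¹ * r.u s)) * r.u t := by rw [← map_mul, ← e5]
    _ = (r.u s * r.π (c * b) * r.u s⁻¹) * (r.u s * r.u t) := by simp only [mul_assoc]
    _ = r.π (α.term x y (s, t)) * (r.u s * r.u t) := by rw [r.covariance s _ hcb]; rfl
    _ = r.π (α.term x y (s, t)) * r.u (s * t) := r.π_u_mul_u h1 h2

theorem integrated_mul (x y : α.L) :
    r.integrated (x * y) = r.integrated x * r.integrated y := by
  have hc : Continuous r.π := by
    exact AddMonoidHomClass.continuous_of_bound r.π 1 (by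
      simpa only [one_mul] using NonUnitalStarAlgHom.norm_apply_le r.π)
  have hs : Summable fun p : G × G => r.π (α.term x y p) * r.u (p.1 * p.2) := by
    refine Summable.of_norm (Summable.of_nonneg_of_le (fun _ => norm_nonneg _) (fun p => ?_)
      (PartialAction.summable_norm_term x y))
    exact r.norm_summand_le (fun _ => α.term x y p) (p.1 * p.2)
  unfold integrated
  rw [tsum_mul_tsum_of_summable_norm (r.summable_norm x) (r.summable_norm y)]
  simp_rw [r.integrated_term x y]
  let T : (Σ g : G, {p : G × G // p.1 * p.2 = g}) → (r.H →L[ℂ] r.H) :=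
    fun q => r.π (α.term x y q.2.1) * r.u (q.2.1.1 * q.2.1.2)
  have hT : Summable T :=
    (Equiv.sigmaFiberEquiv fun p : G × G => p.1 * p.2).summable_iff.mpr hs
  have e1 : ∑' p : G × G, r.π (α.term x y p) * r.u (p.1 * p.2) = ∑' q, T q :=
    ((Equiv.sigmaFiberEquiv fun p : G × G => p.1 * p.2).tsum_eq
      fun p => r.π (α.term x y p) * r.u (p.1 * p.2)).symm
  rw [e1, hT.tsum_sigma' fun g => hT.sigma_factor g]
  congr 1; funext g
  have h1 : Summable fun p : {p : G × G // p.1 * p.2 = g} => α.term x y p.1 :=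
    ((PartialAction.summable_norm_sigma x y).sigma_factor g).of_norm
  have h2 := (h1.hasSum.map r.π hc).mul_right (r.u g)
  rw [PartialAction.mul_apply, ← h2.tsum_eq]
  congr 1; funext p
  show _ = r.π (α.term x y p.1) * r.u (p.1.1 * p.1.2)
  rw [p.2]; rfl

theorem integrated_star (x : α.L) : r.integrated (star x) = star (r.integrated x) := by
  unfold integrated
  rw [tsum_star]
  let i : G ≃ G := ⟨fun g => g⁻¹, fun g => g⁻¹, inv_inv', inv_inv'⟩
  rw [← i.tsum_eq]
  congr 1; funext s
  show r.π ((star x).1 s⁻¹) * r.u s⁻¹ = _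
  have hm : star (x.1 s) ∈ α.D s⁻¹⁻¹ := by rw [inv_inv']; exact α.star_mem (x.2.1 s)
  rw [PartialAction.star_apply, inv_inv', ← r.covariance _ _ hm, star_mul, star_u, map_star,
    inv_inv', mul_assoc, mul_assoc]
  rw [inv_inv'] at hm
  congr 1
  have := r.π_u_u_inv hm
  rwa [map_star] at this

end CovariantRep

/-! ### The crossed product -/

namespace PartialAction

variable {G : Type v} {A : Type u} [UnitalInverseSemigroup G] [NonUnitalCStarAlgebra A]
variable (α : PartialAction G A)

theorem bddAbove_integrated (x : α.L) :
    BddAbove (Set.range fun r : CovariantRep α => ‖r.integrated x‖) :=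
  ⟨_, by rintro _ ⟨r, rfl⟩; exact r.norm_integrated_le x⟩

/-- The seminorm `‖x‖₁ = sup ‖(π × u)(x)‖` on `L`, the supremum being taken over all covariant
representations. -/
noncomputable def seminorm : Seminorm ℂ α.L :=
  Seminorm.of (fun x => ⨆ r : CovariantRep α, ‖r.integrated x‖)
    (fun x y => Real.iSup_le (fun r => by
        rw [r.integrated_add]
        exact (norm_add_le _ _).trans (add_le_add (le_ciSup (α.bddAbove_integrated x) r)
          (le_ciSup (α.bddAbove_integrated y) r)))
      (add_nonneg (Real.iSup_nonneg fun _ => norm_nonneg _)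
        (Real.iSup_nonneg fun _ => norm_nonneg _)))
    (fun c x => by
      simp_rw [CovariantRep.integrated_smul, norm_smul]
      exact (Real.mul_iSup_of_nonneg (norm_nonneg c) _).symm)

theorem seminorm_apply (x : α.L) :
    α.seminorm x = ⨆ r : CovariantRep α, ‖r.integrated x‖ := rfl

theorem norm_integrated_le_seminorm (x : α.L) (r : CovariantRep α) :
    ‖r.integrated x‖ ≤ α.seminorm x :=
  le_ciSup (α.bddAbove_integrated x) r

theorem seminorm_le {x : α.L} {c : ℝ} (hc : 0 ≤ c)
    (h : ∀ r : CovariantRep α, ‖r.integrated x‖ ≤ c) : α.seminorm x ≤ c :=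
  Real.iSup_le h hc

theorem seminorm_mul_le (x y : α.L) : α.seminorm (x * y) ≤ α.seminorm x * α.seminorm y :=
  α.seminorm_le (mul_nonneg (apply_nonneg _ _) (apply_nonneg _ _)) fun r => by
    rw [r.integrated_mul]
    exact (norm_mul_le _ _).trans (mul_le_mul (α.norm_integrated_le_seminorm x r)
      (α.norm_integrated_le_seminorm y r) (norm_nonneg _) (apply_nonneg _ _))

theorem seminorm_star (x : α.L) : α.seminorm (star x) = α.seminorm x := by
  simp only [seminorm_apply, CovariantRep.integrated_star, norm_star]

theorem seminorm_mul_self_le (x : α.L) :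
    α.seminorm x * α.seminorm x ≤ α.seminorm (star x * x) := by
  have h : α.seminorm x ≤ √(α.seminorm (star x * x)) :=
    α.seminorm_le (Real.sqrt_nonneg _) fun r => by
      refine Real.le_sqrt_of_sq_le ?_
      have := α.norm_integrated_le_seminorm (star x * x) r
      rwa [r.integrated_mul, r.integrated_star, CStarRing.norm_star_mul_self, ← sq] at this
  calc α.seminorm x * α.seminorm x
      ≤ √(α.seminorm (star x * x)) * √(α.seminorm (star x * x)) :=
        mul_le_mul h h (apply_nonneg _ _) (Real.sqrt_nonneg _)
    _ = _ := Real.mul_self_sqrt (apply_nonneg _ _)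

/-- The null space `N = {x ∈ L | ‖x‖₁ = 0}`. -/
def N : Submodule ℂ α.L where
  carrier := {x | α.seminorm x = 0}
  zero_mem' := map_zero α.seminorm
  add_mem' := fun {x y} hx hy => le_antisymm
    ((map_add_le_add α.seminorm x y).trans (by rw [hx, hy, add_zero])) (apply_nonneg _ _)
  smul_mem' := fun c x hx => by
    show α.seminorm (c • x) = 0
    rw [map_smul_eq_mul, hx, mul_zero]

theorem mem_N {x : α.L} : x ∈ α.N ↔ α.seminorm x = 0 := Iff.rfl

theorem mem_N_iff {x : α.L} : x ∈ α.N ↔ ∀ r : CovariantRep α, r.integrated x = 0 := by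
  rw [mem_N]
  refine ⟨fun h r => ?_, fun h => le_antisymm (α.seminorm_le le_rfl fun r => ?_)
    (apply_nonneg _ _)⟩
  · exact norm_le_zero_iff.mp (h ▸ α.norm_integrated_le_seminorm x r)
  · rw [h r, norm_zero]

theorem sub_mem_N_iff {x y : α.L} :
    x - y ∈ α.N ↔ ∀ r : CovariantRep α, r.integrated x = r.integrated y := by
  rw [mem_N_iff]
  refine forall_congr' fun r => ?_
  rw [sub_eq_add_neg, r.integrated_add, ← neg_one_smul ℂ y, r.integrated_smul, neg_one_smul,
    ← sub_eq_add_neg, sub_eq_zero]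

/-- The quotient `L / N`. -/
def LmodN : Type (max u v) := α.L ⧸ α.N

noncomputable instance : AddCommGroup α.LmodN := inferInstanceAs (AddCommGroup (α.L ⧸ α.N))
noncomputable instance : Module ℂ α.LmodN := inferInstanceAs (Module ℂ (α.L ⧸ α.N))

/-- The quotient map `Φ : L → L / N`. -/
def Φ : α.L →ₗ[ℂ] α.LmodN := α.N.mkQ

theorem Φ_surjective : Function.Surjective α.Φ := α.N.mkQ_surjective

theorem Φ_eq_iff {x y : α.L} : α.Φ x = α.Φ y ↔ x - y ∈ α.N := Submodule.Quotient.eq α.N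

theorem Φ_eq_iff' {x y : α.L} :
    α.Φ x = α.Φ y ↔ ∀ r : CovariantRep α, r.integrated x = r.integrated y :=
  α.Φ_eq_iff.trans α.sub_mem_N_iff

theorem rel_iff {x y : α.L} : α.N.quotientRel x y ↔
    ∀ r : CovariantRep α, r.integrated x = r.integrated y :=
  α.N.quotientRel_def.trans α.sub_mem_N_iff

/-- The product of `L / N`, induced by the convolution product. -/
noncomputable instance : Mul α.LmodN where
  mul := Quotient.map₂ (· * ·) fun x x' hx y y' hy => by
    have h1 := α.rel_iff.mp hx
    have h2 := α.rel_iff.mp hy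
    exact α.rel_iff.mpr fun r => by
      show r.integrated (x * y) = r.integrated (x' * y')
      rw [r.integrated_mul, r.integrated_mul, h1, h2]

/-- The involution of `L / N`, induced by the involution of `L`. -/
noncomputable instance : Star α.LmodN where
  star := Quotient.map star fun x x' hx => by
    have h1 := α.rel_iff.mp hx
    exact α.rel_iff.mpr fun r => by rw [r.integrated_star, r.integrated_star, h1]

/-- The norm of `L / N`, induced by `‖·‖₁`. -/
noncomputable instance : Norm α.LmodN where
  norm := Quotient.lift (fun x : α.L => α.seminorm x) fun x y h => by
    have h1 := α.rel_iff.mp h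
    simp only [seminorm_apply, h1]

theorem Φ_mul (x y : α.L) : α.Φ (x * y) = α.Φ x * α.Φ y := rfl

theorem Φ_star (x : α.L) : α.Φ (star x) = star (α.Φ x) := rfl

theorem norm_Φ (x : α.L) : ‖α.Φ x‖ = α.seminorm x := rfl

noncomputable instance : NormedAddCommGroup α.LmodN :=
  AddGroupNorm.toNormedAddCommGroup
    { toFun := fun a => ‖a‖
      map_zero' := by rw [← map_zero α.Φ, norm_Φ, map_zero]
      add_le' := fun a b => by
        obtain ⟨x, rfl⟩ := α.Φ_surjective a
        obtain ⟨y, rfl⟩ := α.Φ_surjective b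
        rw [← _root_.map_add]
        exact map_add_le_add α.seminorm x y
      neg' := fun a => by
        obtain ⟨x, rfl⟩ := α.Φ_surjective a
        rw [← map_neg]
        exact map_neg_eq_map α.seminorm x
      eq_zero_of_map_eq_zero' := fun a h => by
        obtain ⟨x, rfl⟩ := α.Φ_surjective a
        rw [← map_zero α.Φ, Φ_eq_iff, sub_zero]
        exact h }

noncomputable instance : NonUnitalNormedRing α.LmodN :=
  { (inferInstance : NormedAddCommGroup α.LmodN), (inferInstance : Mul α.LmodN) with
    left_distrib := fun a b c => by
      obtain ⟨x, rfl⟩ := α.Φ_surjective a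
      obtain ⟨y, rfl⟩ := α.Φ_surjective b
      obtain ⟨z, rfl⟩ := α.Φ_surjective c
      simp only [← _root_.map_add, ← Φ_mul]
      exact α.Φ_eq_iff'.mpr fun r => by
        simp only [r.integrated_mul, r.integrated_add, mul_add]
    right_distrib := fun a b c => by
      obtain ⟨x, rfl⟩ := α.Φ_surjective a
      obtain ⟨y, rfl⟩ := α.Φ_surjective b
      obtain ⟨z, rfl⟩ := α.Φ_surjective c
      simp only [← _root_.map_add, ← Φ_mul]
      exact α.Φ_eq_iff'.mpr fun r => by
        simp only [r.integrated_mul, r.integrated_add, add_mul]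
    zero_mul := fun a => by
      obtain ⟨x, rfl⟩ := α.Φ_surjective a
      rw [← map_zero α.Φ, ← Φ_mul]
      refine α.Φ_eq_iff'.mpr fun r => ?_
      rw [r.integrated_mul, ← zero_smul ℂ (0 : α.L), r.integrated_smul, zero_smul, zero_mul]
    mul_zero := fun a => by
      obtain ⟨x, rfl⟩ := α.Φ_surjective a
      rw [← map_zero α.Φ, ← Φ_mul]
      refine α.Φ_eq_iff'.mpr fun r => ?_
      rw [r.integrated_mul, ← zero_smul ℂ (0 : α.L), r.integrated_smul, zero_smul, mul_zero]
    mul_assoc := fun a b c => by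
      obtain ⟨x, rfl⟩ := α.Φ_surjective a
      obtain ⟨y, rfl⟩ := α.Φ_surjective b
      obtain ⟨z, rfl⟩ := α.Φ_surjective c
      simp only [← Φ_mul]
      exact α.Φ_eq_iff'.mpr fun r => by simp only [r.integrated_mul, mul_assoc]
    norm_mul_le := fun a b => by
      obtain ⟨x, rfl⟩ := α.Φ_surjective a
      obtain ⟨y, rfl⟩ := α.Φ_surjective b
      exact α.seminorm_mul_le x y }

noncomputable instance : StarRing α.LmodN where
  star_involutive := fun a => by
    obtain ⟨x, rfl⟩ := α.Φ_surjective a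
    simp only [← Φ_star]
    exact α.Φ_eq_iff'.mpr fun r => by simp only [r.integrated_star, star_star]
  star_mul := fun a b => by
    obtain ⟨x, rfl⟩ := α.Φ_surjective a
    obtain ⟨y, rfl⟩ := α.Φ_surjective b
    simp only [← Φ_star, ← Φ_mul]
    exact α.Φ_eq_iff'.mpr fun r => by simp only [r.integrated_star, r.integrated_mul, star_mul]
  star_add := fun a b => by
    obtain ⟨x, rfl⟩ := α.Φ_surjective a
    obtain ⟨y, rfl⟩ := α.Φ_surjective b
    simp only [← _root_.map_add, ← Φ_star]
    exact α.Φ_eq_iff'.mpr fun r => by simp only [r.integrated_star, r.integrated_add, star_add]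

noncomputable instance : NormedSpace ℂ α.LmodN where
  norm_smul_le := fun c a => by
    obtain ⟨x, rfl⟩ := α.Φ_surjective a
    rw [← _root_.map_smul]
    exact (map_smul_eq_mul α.seminorm c x).le

instance : IsScalarTower ℂ α.LmodN α.LmodN where
  smul_assoc := fun c a b => by
    obtain ⟨x, rfl⟩ := α.Φ_surjective a
    obtain ⟨y, rfl⟩ := α.Φ_surjective b
    simp only [smul_eq_mul, ← _root_.map_smul, ← Φ_mul]
    exact α.Φ_eq_iff'.mpr fun r => by
      simp only [r.integrated_mul, r.integrated_smul, smul_mul_assoc]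

instance : SMulCommClass ℂ α.LmodN α.LmodN where
  smul_comm := fun c a b => by
    obtain ⟨x, rfl⟩ := α.Φ_surjective a
    obtain ⟨y, rfl⟩ := α.Φ_surjective b
    simp only [smul_eq_mul, ← _root_.map_smul, ← Φ_mul]
    exact α.Φ_eq_iff'.mpr fun r => by
      simp only [r.integrated_mul, r.integrated_smul, mul_smul_comm]

instance : StarModule ℂ α.LmodN where
  star_smul := fun c a => by
    obtain ⟨x, rfl⟩ := α.Φ_surjective a
    simp only [← _root_.map_smul, ← Φ_star]
    exact α.Φ_eq_iff'.mpr fun r => by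
      simp only [r.integrated_star, r.integrated_smul, star_smul]

instance : CStarRing α.LmodN where
  norm_mul_self_le := fun a => by
    obtain ⟨x, rfl⟩ := α.Φ_surjective a
    exact α.seminorm_mul_self_le x

/-- The crossed product of `A` by the partial action `α` of `G`: the completion of `L / N` with
respect to `‖·‖₁`. -/
def CrossedProduct : Type (max u v) := Completion α.LmodN

namespace CrossedProduct

noncomputable instance : NormedAddCommGroup α.CrossedProduct :=
  inferInstanceAs (NormedAddCommGroup (Completion α.LmodN))
noncomputable instance : NormedSpace ℂ α.CrossedProduct :=
  inferInstanceAs (NormedSpace ℂ (Completion α.LmodN))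
instance : CompleteSpace α.CrossedProduct := inferInstanceAs (CompleteSpace (Completion α.LmodN))

/-- The canonical embedding of `L / N` into its completion. -/
noncomputable def ι : α.LmodN →ₗᵢ[ℂ] α.CrossedProduct :=
  Completion.toComplₗᵢ (𝕜 := ℂ) (E := α.LmodN)

theorem isDenseInducing_ι : IsDenseInducing (ι α) :=
  Completion.isDenseInducing_coe (α := α.LmodN)

variable {α}

theorem induction_on {p : α.CrossedProduct → Prop} (a : α.CrossedProduct)
    (hp : IsClosed {a | p a}) (ih : ∀ a, p (ι α a)) : p a :=
  Completion.induction_on (α := α.LmodN) a hp ih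

theorem induction_on₂ {p : α.CrossedProduct → α.CrossedProduct → Prop} (a b : α.CrossedProduct)
    (hp : IsClosed {x : α.CrossedProduct × α.CrossedProduct | p x.1 x.2})
    (ih : ∀ a b, p (ι α a) (ι α b)) : p a b :=
  Completion.induction_on₂ (α := α.LmodN) (β := α.LmodN) a b hp ih

theorem induction_on₃ {p : α.CrossedProduct → α.CrossedProduct → α.CrossedProduct → Prop}
    (a b c : α.CrossedProduct)
    (hp : IsClosed {x : α.CrossedProduct × α.CrossedProduct × α.CrossedProduct |
      p x.1 x.2.1 x.2.2})
    (ih : ∀ a b c, p (ι α a) (ι α b) (ι α c)) : p a b c :=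
  Completion.induction_on₃ (α := α.LmodN) (β := α.LmodN) (γ := α.LmodN) a b c hp ih

/-- The product: the continuous extension of the product of `L / N`. -/
noncomputable instance : Mul α.CrossedProduct where
  mul a b := ((isDenseInducing_ι α).prodMap (isDenseInducing_ι α)).extend
    (fun p : α.LmodN × α.LmodN => ι α (p.1 * p.2)) (a, b)

/-- The involution: the continuous extension of the involution of `L / N`. -/
noncomputable instance : Star α.CrossedProduct where
  star := (isDenseInducing_ι α).extend fun a : α.LmodN => ι α (star a)

theorem ι_mul (a b : α.LmodN) : ι α (a * b) = ι α a * ι α b :=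
  (((isDenseInducing_ι α).prodMap (isDenseInducing_ι α)).extend_eq
    ((ι α).continuous.comp continuous_mul) (a, b)).symm

instance : ContinuousMul α.CrossedProduct where
  continuous_mul := by
    let j : α.LmodN →+ α.CrossedProduct := (ι α).toLinearMap.toAddMonoidHom
    let m := (AddMonoidHom.mul : α.LmodN →+ α.LmodN →+ α.LmodN).compr₂ j
    have hm : Continuous fun p : α.LmodN × α.LmodN => m p.1 p.2 :=
      (ι α).continuous.comp continuous_mul
    have di : IsDenseInducing j := isDenseInducing_ι α
    exact (di.extend_Z_bilin di hm :)

theorem ι_star (a : α.LmodN) : ι α (star a) = star (ι α a) :=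
  ((isDenseInducing_ι α).extend_eq ((ι α).continuous.comp continuous_star) a).symm

instance : ContinuousStar α.CrossedProduct where
  continuous_star := by
    have hu : UniformContinuous fun a : α.LmodN => ι α (star a) :=
      (ι α).isometry.uniformContinuous.comp
        (starₗᵢ ℂ : α.LmodN ≃ₗᵢ⋆[ℂ] α.LmodN).isometry.uniformContinuous
    exact uniformContinuous_uniformly_extend (ι α).isometry.isUniformInducing
      (isDenseInducing_ι α).dense hu |>.continuous

noncomputable instance : NonUnitalNormedRing α.CrossedProduct :=
  { (inferInstance : NormedAddCommGroup α.CrossedProduct),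
    (inferInstance : Mul α.CrossedProduct) with
    left_distrib := fun a b c => by
      induction a, b, c using induction_on₃ with
      | hp => exact isClosed_eq (by fun_prop) (by fun_prop)
      | ih a b c => simp only [← _root_.map_add, ← ι_mul, mul_add]
    right_distrib := fun a b c => by
      induction a, b, c using induction_on₃ with
      | hp => exact isClosed_eq (by fun_prop) (by fun_prop)
      | ih a b c => simp only [← _root_.map_add, ← ι_mul, add_mul]
    zero_mul := fun a => by
      induction a using induction_on with
      | hp => exact isClosed_eq (by fun_prop) (by fun_prop)
      | ih a => rw [← map_zero (ι α), ← ι_mul, zero_mul]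
    mul_zero := fun a => by
      induction a using induction_on with
      | hp => exact isClosed_eq (by fun_prop) (by fun_prop)
      | ih a => rw [← map_zero (ι α), ← ι_mul, mul_zero]
    mul_assoc := fun a b c => by
      induction a, b, c using induction_on₃ with
      | hp => exact isClosed_eq (by fun_prop) (by fun_prop)
      | ih a b c => simp only [← ι_mul, mul_assoc]
    norm_mul_le := fun a b => by
      induction a, b using induction_on₂ with
      | hp => exact isClosed_le (by fun_prop) (by fun_prop)
      | ih a b => simpa only [← ι_mul, LinearIsometry.norm_map] using norm_mul_le a b }

noncomputable instance : StarRing α.CrossedProduct where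
  star_involutive := fun a => by
      induction a using induction_on with
      | hp => exact isClosed_eq (by fun_prop) (by fun_prop)
      | ih a => simp only [← ι_star, star_star]
  star_mul := fun a b => by
      induction a, b using induction_on₂ with
      | hp => exact isClosed_eq (by fun_prop) (by fun_prop)
      | ih a b => simp only [← ι_star, ← ι_mul, star_mul]
  star_add := fun a b => by
      induction a, b using induction_on₂ with
      | hp => exact isClosed_eq (by fun_prop) (by fun_prop)
      | ih a b => simp only [← _root_.map_add, ← ι_star, star_add]

noncomputable instance : NormedSpace ℂ α.CrossedProduct :=
  inferInstanceAs (NormedSpace ℂ (Completion α.LmodN))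

instance : IsScalarTower ℂ α.CrossedProduct α.CrossedProduct where
  smul_assoc := fun c a b => by
    induction a, b using induction_on₂ with
    | hp => exact isClosed_eq ((continuous_fst.const_smul c).mul continuous_snd)
              ((continuous_fst.mul continuous_snd).const_smul c)
    | ih a b => simp only [smul_eq_mul, ← _root_.map_smul, ← ι_mul, smul_mul_assoc]

instance : SMulCommClass ℂ α.CrossedProduct α.CrossedProduct where
  smul_comm := fun c a b => by
    induction a, b using induction_on₂ with
    | hp => exact isClosed_eq ((continuous_fst.mul continuous_snd).const_smul c)
              (continuous_fst.mul (continuous_snd.const_smul c))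
    | ih a b => simp only [smul_eq_mul, ← _root_.map_smul, ← ι_mul, mul_smul_comm]

instance : StarModule ℂ α.CrossedProduct where
  star_smul := fun c a => by
    induction a using induction_on with
    | hp => exact isClosed_eq (continuous_id.const_smul c).star
              (continuous_star.const_smul (star c))
    | ih a => simp only [← _root_.map_smul, ← ι_star, star_smul]

instance : CStarRing α.CrossedProduct where
  norm_mul_self_le := fun a => by
    induction a using induction_on with
    | hp => exact isClosed_le (by fun_prop) (by fun_prop)
    | ih a =>
      simpa only [← ι_star, ← ι_mul, LinearIsometry.norm_map] using CStarRing.norm_mul_self_le a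

/-- The crossed product is a C⋆-algebra. -/
noncomputable instance : NonUnitalCStarAlgebra α.CrossedProduct where

end CrossedProduct

end PartialAction

end PartialCrossedProduct

/-! In a semilattice `s⁻¹ = s`, so each `β_s` is an involution of `E_s`; since `s * s = s` it is
also idempotent, hence the identity (`act_eq_self`). The partial action is then only a family of
ideals with `E_s ∩ E_t = E_s ∩ E_{st}`. In a covariant representation `π a * u s = π a` for `a ∈
E_s` (`π_mul_u`), so the integrated form sees an element `x` of `L` only through its total sum: `(π
× ν)(x) = π(∑ x(s))` (`integrated_eq`).

It follows that `‖x‖₁ = ‖∑ x(s)‖` (`seminorm_eq`). The bound `≤` holds because representations are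
contractive. For `≥` there must be enough covariant representations: any non-degenerate `π` becomes
covariant when `ν_s` is the projection onto the closed span of `π(E_s)H` (`ofRepresentation`), and
some non-degenerate `π` attains the norm of a given element (`exists_representation`, by the GNS
construction).

Functions supported at the unit therefore embed `A` isometrically in the crossed product. Modulo `N`
every `x` equals the function at the unit with value `∑ x(s)`, so the range contains the dense
subspace `L / N`; it is closed because `A` is complete, hence it is everything. -/

namespace ContinuousLinearMap

/-! ### Positivity of contractive functionals with value `1` at the unit. -/

open scoped ComplexOrder CStarAlgebra

variable {B : Type*} [CStarAlgebra B] {f : B →L[ℂ] ℂ}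

/-- Replacing `x` by `x + it` shifts the imaginary part of `f x` by `t`, while the squared norm is
at most `‖x‖² + t²`. A nonzero imaginary part would leave a cross term linear in `t`, unbounded over
real `t`. -/
theorem im_apply_of_isSelfAdjoint (hf : ‖f‖ ≤ 1) (hf1 : f 1 = 1) {x : B} (hx : IsSelfAdjoint x) :
    (f x).im = 0 := by
  have key : ∀ t : ℝ, ((f x).im + t) ^ 2 ≤ ‖x‖ ^ 2 + t ^ 2 := fun t => by
    set y : B := x + (t * Complex.I) • 1 with hy
    have h1 : star y * y = x * x + ((t : ℂ) ^ 2) • 1 := by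
      rw [hy, star_add, hx.star_eq, star_smul, star_one]
      simp only [star_mul', RCLike.star_def, Complex.conj_ofReal, Complex.conj_I]
      simp only [add_mul, mul_add, smul_mul_assoc, mul_smul_comm, one_mul, mul_one, smul_add,
        smul_smul]
      have : (t * Complex.I) * (t * -Complex.I) = (t : ℂ) ^ 2 := by
        linear_combination (-(t : ℂ) ^ 2) * Complex.I_sq
      rw [this]
      module
    have h2 : ‖y‖ ^ 2 ≤ ‖x‖ ^ 2 + t ^ 2 := by
      rw [sq, ← CStarRing.norm_star_mul_self, h1]
      refine (norm_add_le _ _).trans (add_le_add ((norm_mul_le _ _).trans_eq (sq _).symm) ?_)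
      rw [norm_smul]
      rcases subsingleton_or_nontrivial B with hB | hB
      · rw [Subsingleton.elim (1 : B) 0]; simp [sq_nonneg]
      · simp
    have h3 : f y = f x + t * Complex.I := by
      rw [hy, _root_.map_add, _root_.map_smul, hf1, smul_eq_mul, mul_one]
    have h4 : ‖f y‖ ≤ ‖y‖ := (f.le_opNorm y).trans (mul_le_of_le_one_left (norm_nonneg _) hf)
    have h5 : |(f y).im| ≤ ‖y‖ := (Complex.abs_im_le_norm _).trans h4
    have h6 : (f y).im = (f x).im + t := by rw [h3]; simp
    rw [← h6, ← sq_abs]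
    exact (pow_le_pow_left₀ (abs_nonneg _) h5 2).trans h2
  by_contra h
  -- This `t` makes the cross term `2 t Im (f x)` equal to `‖x‖² + 1`, one more than the bound
  -- allows.
  have := key ((‖x‖ ^ 2 + 1) / (2 * (f x).im))
  have e : 2 * (f x).im * ((‖x‖ ^ 2 + 1) / (2 * (f x).im)) = ‖x‖ ^ 2 + 1 := by field_simp
  nlinarith [sq_nonneg (f x).im]

/-- A contractive functional with value `1` at `1` is positive. -/
theorem apply_nonneg_of_norm_le_one [PartialOrder B] [StarOrderedRing B] (hf : ‖f‖ ≤ 1)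
    (hf1 : f 1 = 1) {x : B} (hx : 0 ≤ x) : 0 ≤ f x := by
  have him := im_apply_of_isSelfAdjoint hf hf1 (IsSelfAdjoint.of_nonneg hx)
  rw [Complex.nonneg_iff]
  refine ⟨?_, him.symm⟩
  -- From `0 ≤ ‖x‖ - x ≤ ‖x‖`. Applying `f` gives `|‖x‖ - f x| ≤ ‖x‖`, which forces the real part of
  -- `f x` to be nonnegative.
  have h1 : ‖algebraMap ℝ B ‖x‖ - x‖ ≤ ‖x‖ := by
    rw [CStarAlgebra.norm_le_iff_le_algebraMap _ (norm_nonneg x)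
      (sub_nonneg.mpr (IsSelfAdjoint.le_algebraMap_norm_self (IsSelfAdjoint.of_nonneg hx)))]
    exact sub_le_self _ hx
  have h2 : f (algebraMap ℝ B ‖x‖ - x) = ‖x‖ - f x := by
    rw [_root_.map_sub, Algebra.algebraMap_eq_smul_one, ← Complex.coe_smul, _root_.map_smul, hf1,
      smul_eq_mul, mul_one]
  have h3 : ‖f (algebraMap ℝ B ‖x‖ - x)‖ ≤ ‖x‖ :=
    ((f.le_opNorm _).trans (mul_le_of_le_one_left (norm_nonneg _) hf)).trans h1
  rw [h2] at h3
  have h4 := (Complex.re_le_norm _).trans h3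
  simp at h4
  exact h4

end ContinuousLinearMap

/-! ### Functionals that norm a positive element. -/

namespace CStarAlgebra

open scoped ComplexOrder CStarAlgebra

/-- A contractive functional with value `1` at `1` that is multiplicative on the powers of a positive element `h` and attains its
norm there. -/
theorem exists_contractive_functional {B : Type*} [CStarAlgebra B] [PartialOrder B]
    [StarOrderedRing B] [Nontrivial B] {h : B} (hh : 0 ≤ h) :
    ∃ f : B →L[ℂ] ℂ, ‖f‖ ≤ 1 ∧ f 1 = 1 ∧ ∀ n : ℕ, f (h ^ n) = (‖h‖ : ℂ) ^ n := by
  have hn : IsStarNormal h := (IsSelfAdjoint.of_nonneg hh).isStarNormal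
  -- The norm of a positive element is a point of its spectrum. Evaluation there is a character of
  -- the C⋆-subalgebra generated by `h` and `1`.
  have hs : (‖h‖ : ℂ) ∈ spectrum ℂ h :=
    spectrum.algebraMap_mem ℂ (norm_mem_spectrum_of_nonneg hh)
  let χ : StarAlgebra.elemental ℂ h →⋆ₐ[ℂ] ℂ :=
    (ContinuousMap.evalStarAlgHom ℂ ℂ (⟨_, hs⟩ : spectrum ℂ h)).comp
      ((continuousFunctionalCalculus h).symm : StarAlgebra.elemental ℂ h →⋆ₐ[ℂ] C(spectrum ℂ h, ℂ))
  have hχ : ∀ x, ‖χ x‖ ≤ ‖x‖ := fun x => NonUnitalStarAlgHom.norm_apply_le χ x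
  let φ : StarAlgebra.elemental ℂ h →L[ℂ] ℂ :=
    LinearMap.mkContinuous χ.toAlgHom.toLinearMap 1 (by simpa using hχ)
  -- The Hahn-Banach extension need not be multiplicative on `B`, but it agrees with the character
  -- on the powers of `h`.
  obtain ⟨f, hf, hnf⟩ := exists_extension_norm_eq
    (Subalgebra.toSubmodule (StarAlgebra.elemental ℂ h).toSubalgebra) φ
  have hφ : ‖φ‖ ≤ 1 := LinearMap.mkContinuous_norm_le _ zero_le_one _
  let h' : StarAlgebra.elemental ℂ h := ⟨h, StarAlgebra.elemental.self_mem ℂ h⟩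
  have hχh : χ h' = ‖h‖ := by
    have := continuousFunctionalCalculus_map_id h
    have h2 : (continuousFunctionalCalculus h).symm h' = .restrict (spectrum ℂ h) (.id ℂ) := by
      rw [StarAlgEquiv.symm_apply_eq, this]
    show ((continuousFunctionalCalculus h).symm h') ⟨_, hs⟩ = _
    rw [h2]; rfl
  refine ⟨f, hnf.trans_le hφ, ?_, fun n => ?_⟩
  · exact (hf (1 : StarAlgebra.elemental ℂ h)).trans (show χ 1 = 1 from map_one χ)
  · exact (hf (h' ^ n : StarAlgebra.elemental ℂ h)).trans (show χ (h' ^ n) = _ by rw [map_pow, hχh])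

/-- A positive functional on a non-unital C⋆-algebra that norms a positive element `h`. -/
theorem exists_positive_functional {A : Type*} [NonUnitalCStarAlgebra A] [PartialOrder A]
    [StarOrderedRing A] {h : A} (hh : 0 ≤ h) :
    ∃ f : A →ₚ[ℂ] ℂ, f (h * h) = (‖h‖ : ℂ) ^ 2 ∧ f (h * h * h) = (‖h‖ : ℂ) ^ 3 := by
  -- The criterion for positivity uses a unit, so the functional is built on the unitization and
  -- restricted to `A`.
  let _ := CStarAlgebra.spectralOrder A⁺¹
  have := CStarAlgebra.spectralOrderedRing A⁺¹
  obtain ⟨f, hf, hf1, hp⟩ := exists_contractive_functional (B := A⁺¹) (h := (h : A⁺¹))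
    (Unitization.inr_nonneg_iff.mpr hh)
  rw [Unitization.norm_inr] at hp
  refine ⟨.mk₀ ((f : A⁺¹ →ₗ[ℂ] ℂ).comp (Unitization.inrNonUnitalStarAlgHom ℂ A : A →ₗ[ℂ] A⁺¹))
    (fun x hx => f.apply_nonneg_of_norm_le_one hf hf1 (Unitization.inr_nonneg_iff.mpr hx)), ?_, ?_⟩
  · rw [← hp]; exact congrArg f (by simp [pow_two])
  · rw [← hp]; exact congrArg f (by simp [pow_succ])

end CStarAlgebra

/-! ### The GNS representation of a norming functional. -/

namespace PositiveLinearMap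

open scoped ComplexOrder

variable {A : Type*} [NonUnitalCStarAlgebra A] [PartialOrder A] [StarOrderedRing A]
  (f : A →ₚ[ℂ] ℂ)

/-- Positive functionals are automatically continuous, hence so is the GNS seminorm `z ↦ √f(z⋆z)`.
-/
theorem tendsto_toPreGNS {ι : Type*} {l : Filter ι} {x : ι → A} {y : A}
    (h : Filter.Tendsto x l (𝓝 y)) :
    Filter.Tendsto (fun i => f.toPreGNS (x i)) l (𝓝 (f.toPreGNS y)) := by
  rw [tendsto_iff_norm_sub_tendsto_zero]
  have hf : Continuous f := map_continuous f
  have hc : Continuous fun z : A => √(f (star (z - y) * (z - y))).re := by fun_prop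
  have := (hc.tendsto y).comp h
  simpa [Function.comp_def, preGNS_norm_def, ← map_sub] using this

/-- The GNS representation is non-degenerate. -/
theorem closedSpan_gns :
    PartialCrossedProduct.closedSpan f.gnsNonUnitalStarAlgHom Set.univ = ⊤ := by
  rw [eq_top_iff]
  rintro k -
  refine Completion.induction_on k (Submodule.isClosed_topologicalClosure _) fun b => ?_
  -- The class of `b` is the limit of the classes of `b * e n`, which are the vectors `π(b)` applied
  -- to the class of `e n`.
  obtain ⟨e, -, -, ht⟩ := PartialCrossedProduct.exists_approx (f.ofPreGNS b)
  have h1 := ((Completion.continuous_coe f.PreGNS).tendsto _).comp (f.tendsto_toPreGNS ht)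
  refine (Submodule.isClosed_topologicalClosure _).mem_of_tendsto h1
    (Filter.Eventually.of_forall fun n => ?_)
  have := PartialCrossedProduct.mem_closedSpan f.gnsNonUnitalStarAlgHom
    (Set.mem_univ (f.ofPreGNS b)) (f.toPreGNS (e n) : f.GNS)
  rwa [gnsNonUnitalStarAlgHom_apply_coe] at this

/-- Without a unit the class of `1` is not available as a test vector; the class of `h = a⋆a` serves
instead. Its squared norm is `f(h²) = ‖h‖²`, and `π(a)` sends it to a vector of squared norm `f(h³)
= ‖h‖³ = ‖a‖² ‖h‖²`. -/
theorem norm_le_norm_gns {a : A} (h2 : f (star a * a * (star a * a)) = (‖star a * a‖ : ℂ) ^ 2)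
    (h3 : f (star a * a * (star a * a) * (star a * a)) = (‖star a * a‖ : ℂ) ^ 3) :
    ‖a‖ ≤ ‖f.gnsNonUnitalStarAlgHom a‖ := by
  set h := star a * a with hh
  have hs : star h = h := by rw [hh, star_mul, star_star]
  have e2 : ‖(f.toPreGNS h : f.GNS)‖ ^ 2 = ‖h‖ ^ 2 := by
    have := f.preGNS_norm_sq (f.toPreGNS h)
    rw [ofPreGNS_toPreGNS, hs, h2] at this
    rw [Completion.norm_coe]
    exact_mod_cast this
  have e3 : ‖f.gnsNonUnitalStarAlgHom a (f.toPreGNS h)‖ ^ 2 = ‖h‖ ^ 3 := by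
    have := f.preGNS_norm_sq (f.toPreGNS (a * h))
    have e : star (a * h) * (a * h) = h * h * h := by
      rw [star_mul, hs]
      simp only [hh, mul_assoc]
    rw [ofPreGNS_toPreGNS, e, h3] at this
    rw [gnsNonUnitalStarAlgHom_apply_coe, Completion.norm_coe, leftMulMapPreGNS_apply]
    exact_mod_cast this
  have e4 := pow_le_pow_left₀ (norm_nonneg _)
    ((f.gnsNonUnitalStarAlgHom a).le_opNorm (f.toPreGNS h)) 2
  rw [mul_pow, e2, e3] at e4
  have e5 : ‖h‖ = ‖a‖ ^ 2 := by rw [hh, CStarRing.norm_star_mul_self, sq]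
  -- The case `a = 0` is separate because `‖h‖²` is cancelled below.
  rcases (norm_nonneg a).eq_or_lt with h0 | h0
  · rw [← h0]; exact norm_nonneg _
  have h0' : 0 < ‖h‖ ^ 2 := by rw [e5]; positivity
  refine le_of_sq_le_sq ?_ (norm_nonneg _)
  rw [← e5]
  exact le_of_mul_le_mul_right (by linarith) h0'

end PositiveLinearMap

/-! ### Non-degenerate representations attaining a norm, in the required universe. -/

namespace PartialCrossedProduct

universe u v

/-- The isometric isomorphism of a Hilbert space with a copy of it in a larger universe. -/
noncomputable def liftHilbert (H : Type u) [NormedAddCommGroup H] [InnerProductSpace ℂ H] :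
    H ≃ₗᵢ[ℂ] PiLp 2 (fun _ : PUnit.{v + 1} => H) where
  toLinearEquiv := (LinearEquiv.funUnique PUnit.{v + 1} ℂ H).symm.trans
    (WithLp.linearEquiv 2 ℂ (PUnit.{v + 1} → H)).symm
  norm_map' x := by simp [PiLp.norm_eq_of_L2]

section Conj

variable {A : Type*} [NonUnitalCStarAlgebra A] {H K : Type*}
  [NormedAddCommGroup H] [InnerProductSpace ℂ H] [CompleteSpace H]
  [NormedAddCommGroup K] [InnerProductSpace ℂ K] [CompleteSpace K]
  (e : H ≃ₗᵢ[ℂ] K) (π : A →⋆ₙₐ[ℂ] (H →L[ℂ] H))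

/-- The transport of a representation along an isometric isomorphism of Hilbert spaces. -/
noncomputable def conjRepresentation : A →⋆ₙₐ[ℂ] (K →L[ℂ] K) where
  toFun a := e.conjStarAlgEquiv (π a)
  map_smul' c a := by simp only [_root_.map_smul]; rfl
  map_zero' := by simp only [_root_.map_zero]
  map_add' a b := by simp only [_root_.map_add]
  map_mul' a b := by simp only [_root_.map_mul]
  map_star' a := by simp only [map_star]

theorem conjRepresentation_apply (a : A) (k : K) :
    conjRepresentation e π a k = e (π a (e.symm k)) := rfl

theorem norm_le_norm_conjRepresentation (a : A) : ‖π a‖ ≤ ‖conjRepresentation e π a‖ := by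
  refine (π a).opNorm_le_bound (norm_nonneg _) fun h => ?_
  have := (conjRepresentation e π a).le_opNorm (e h)
  rwa [conjRepresentation_apply, e.symm_apply_apply, e.norm_map, e.norm_map] at this

variable {π}

theorem closedSpan_conjRepresentation (hπ : closedSpan π Set.univ = ⊤) :
    closedSpan (conjRepresentation e π) Set.univ = ⊤ := by
  set ρ := conjRepresentation e π
  rw [eq_top_iff]
  rintro k -
  have h1 : closedSpan π Set.univ ≤ (closedSpan ρ Set.univ).comap e.toLinearEquiv.toLinearMap := by
    refine Submodule.topologicalClosure_minimal _ (Submodule.span_le.mpr ?_)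
      ((Submodule.isClosed_topologicalClosure _).preimage e.continuous)
    rintro _ ⟨a, ha, h, rfl⟩
    have := mem_closedSpan ρ ha (e h)
    rwa [conjRepresentation_apply, e.symm_apply_apply] at this
  have h2 := h1 (x := e.symm k) (by rw [hπ]; trivial)
  simpa using h2

end Conj

/-- Every element of a C⋆-algebra attains its norm in some non-degenerate representation. -/
theorem exists_representation {A : Type u} [NonUnitalCStarAlgebra A] (a : A) :
    ∃ (H : Type (max u v)) (_ : NormedAddCommGroup H) (_ : InnerProductSpace ℂ H)
      (_ : CompleteSpace H) (π : A →⋆ₙₐ[ℂ] (H →L[ℂ] H)),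
      closedSpan π Set.univ = ⊤ ∧ ‖a‖ ≤ ‖π a‖ := by
  let _ := CStarAlgebra.spectralOrder A
  have := CStarAlgebra.spectralOrderedRing A
  obtain ⟨f, h2, h3⟩ := CStarAlgebra.exists_positive_functional (star_mul_self_nonneg a)
  -- The GNS space lives in the universe of `A`, whereas covariant representations live in the
  -- maximum of the universes of `A` and `G`.
  let e := liftHilbert.{u, v} f.GNS
  exact ⟨_, _, _, inferInstance, conjRepresentation e f.gnsNonUnitalStarAlgHom,
    closedSpan_conjRepresentation e f.closedSpan_gns,
    (f.norm_le_norm_gns h2 h3).trans (norm_le_norm_conjRepresentation e _ a)⟩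

end PartialCrossedProduct

/-! ### Partial actions and covariant representations of a semilattice. -/

namespace PartialCrossedProduct

open UnitalInverseSemigroup

universe u v

theorem IsSemilattice.inv_eq {G : Type v} [UnitalInverseSemigroup G] (hG : IsSemilattice G)
    (s : G) : s⁻¹ = s :=
  inv_of_idem (hG s)

theorem closedSpan_mono {A : Type*} [NonUnitalCStarAlgebra A] {H : Type*} [NormedAddCommGroup H]
    [InnerProductSpace ℂ H] [CompleteSpace H] (π : A →⋆ₙₐ[ℂ] (H →L[ℂ] H)) {I J : Set A}
    (h : I ⊆ J) : closedSpan π I ≤ closedSpan π J :=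
  Submodule.topologicalClosure_mono (Submodule.span_mono fun _ ⟨a, ha, k, hk⟩ => ⟨a, h ha, k, hk⟩)

namespace PartialAction

variable {G : Type v} {A : Type u} [UnitalInverseSemigroup G] [NonUnitalCStarAlgebra A]
variable {α : PartialAction G A}

/-- As `s⁻¹ = s`, the map is its own inverse; as `s * s = s`, it equals its own square. Hence `x =
β_s (β_s x) = β_s x`. -/
theorem act_eq_self (hG : IsSemilattice G) {s : G} {x : A} (hx : x ∈ α.D s) :
    α.act s x = x := by
  have h : ∀ {y}, y ∈ α.D s → α.act s (α.act s y) = y := fun {y} hy => by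
    have := α.act_act_inv hy
    rwa [hG.inv_eq] at this
  have h2 := α.act_act s s (x := x) (by rwa [hG.inv_eq]) (by rwa [hG.inv_eq, hG])
  rw [hG, h hx] at h2
  exact h2.symm

/-- This is axiom (ii) once `β_s` is known to be the identity: the image on its left-hand side is
the intersection itself. -/
theorem inter_D_eq (hG : IsSemilattice G) (s t : G) :
    (α.D s : Set A) ∩ α.D t = (α.D s : Set A) ∩ α.D (s * t) := by
  rw [← α.image_act, hG.inv_eq]
  ext x
  refine ⟨fun hx => ⟨x, hx, act_eq_self hG hx.1⟩, ?_⟩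
  rintro ⟨y, hy, rfl⟩
  rwa [act_eq_self hG hy.1]

end PartialAction

namespace CovariantRep

variable {G : Type v} {A : Type u} [UnitalInverseSemigroup G] [NonUnitalCStarAlgebra A]
variable {α : PartialAction G A}

/-- The product `π a * u s * u s` is computed twice: it is `π a * u s` because `s * s = s`, and it
is `π a` because `u s * u s⁻¹` is absorbed by `π a` and `s⁻¹ = s`. -/
theorem π_mul_u (hG : IsSemilattice G) (r : CovariantRep α) {s : G} {a : A} (ha : a ∈ α.D s) :
    r.π a * r.u s = r.π a := by
  have h1 := r.π_u_mul_u (s := s) (t := s) ha (by rwa [hG])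
  have h2 := r.π_u_u_inv ha
  rw [hG.inv_eq] at h2
  rw [hG, h2] at h1
  exact h1.symm

theorem integrated_eq (hG : IsSemilattice G) (r : CovariantRep α) (x : α.L) :
    r.integrated x = r.π (∑' s, x.1 s) := by
  have hc : Continuous r.π := by
    exact AddMonoidHomClass.continuous_of_bound r.π 1 (by
      simpa only [one_mul] using NonUnitalStarAlgHom.norm_apply_le r.π)
  rw [← (x.2.2.of_norm.hasSum.map r.π hc).tsum_eq]
  exact tsum_congr fun s => r.π_mul_u hG (x.2.1 s)

/-- Over a semilattice, every non-degenerate representation `π` extends to a covariant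
representation, in which `u s` is the projection onto `π(D s)H`. -/
noncomputable def ofRepresentation (hG : IsSemilattice G) {H : Type (max u v)}
    [NormedAddCommGroup H] [InnerProductSpace ℂ H] [CompleteSpace H]
    (π : A →⋆ₙₐ[ℂ] (H →L[ℂ] H)) (hπ : closedSpan π Set.univ = ⊤) : CovariantRep α :=
  have := fun I => closedSpan_hasProj π I
  { H := H
    π := π
    nondegenerate := hπ
    u := fun s => (closedSpan π (α.D s)).starProjection
    isPartialIsometry := fun s => by
      rw [hG.inv_eq]
      refine ⟨fun h hh => by rw [Submodule.starProjection_eq_self_iff.mpr hh],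
        fun h hh => (Submodule.starProjection_apply_eq_zero_iff _).mpr hh, ?_⟩
      exact congrArg (fun M : Submodule ℂ H => (M : Set H))
        (Submodule.range_starProjection (closedSpan π (α.D s)))
    covariance := fun s a ha => by
      rw [hG.inv_eq] at ha ⊢
      rw [PartialAction.act_eq_self hG ha]
      have h1 : ∀ b ∈ α.D s, (closedSpan π (α.D s)).starProjection * π b = π b := fun b hb => by
        ext h
        exact Submodule.starProjection_eq_self_iff.mpr (mem_closedSpan π hb h)
      -- Ideals are closed under `star`, so taking adjoints shows that the projection is also
      -- absorbed on the right of `π a`.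
      have h2 := congrArg star (h1 _ (α.star_mem ha))
      rw [star_mul, map_star, star_star, (isSelfAdjoint_starProjection _).star_eq] at h2
      rw [h1 a ha, h2]
    mul_u := fun s t h hh => by
      rw [hG.inv_eq, hG.inv_eq] at hh
      -- The hypothesis on `h` involves `D (t * s)` but the projection to be applied belongs to `s *
      -- t`.
      have hc : s * t = t * s := idem_comm (hG s) (hG t)
      have h1 : (α.D t : Set A) * (α.D (t * s) : Set A) ⊆ (α.D t : Set A) ∩ α.D (t * s) :=
        Set.mul_subset_iff.mpr fun x hx y hy =>
          ⟨α.mul_mem_right _ _ hx, α.mul_mem_left _ _ hy⟩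
      have ht := closedSpan_mono π (h1.trans Set.inter_subset_left) hh
      have hts := closedSpan_mono π (h1.trans Set.inter_subset_right) hh
      -- Since `D t ∩ D (t * s) = D t ∩ D s`, the vector also lies in the range of the projection
      -- for `s`. It is thus fixed by all three projections.
      rw [← PartialAction.inter_D_eq hG] at h1
      have hs := closedSpan_mono π (h1.trans Set.inter_subset_right) hh
      show Submodule.starProjection _ h = Submodule.starProjection _ (Submodule.starProjection _ h)
      rw [Submodule.starProjection_eq_self_iff.mpr ht, Submodule.starProjection_eq_self_iff.mpr hs,
        Submodule.starProjection_eq_self_iff, hc]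
      exact hts
    inv_u := fun s => by
      rw [hG.inv_eq]
      exact (isSelfAdjoint_starProjection _).star_eq.symm }

end CovariantRep

/-! ### The norm of the crossed product and the isomorphism. -/

namespace PartialAction

variable {G : Type v} {A : Type u} [UnitalInverseSemigroup G] [NonUnitalCStarAlgebra A]
variable (α : PartialAction G A)

/-- Every integrated form is a contractive `π` applied to the total sum, which bounds the supremum
above. A non-degenerate representation attaining the norm of that sum, made covariant by
projections, shows that the bound is reached. -/
theorem seminorm_eq (hG : IsSemilattice G) (x : α.L) : α.seminorm x = ‖∑' s, x.1 s‖ := by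
  refine le_antisymm (α.seminorm_le (norm_nonneg _) fun r => ?_) ?_
  · rw [r.integrated_eq hG]
    exact NonUnitalStarAlgHom.norm_apply_le r.π _
  · obtain ⟨H, _, _, _, π, hπ, h⟩ := exists_representation.{u, v} (∑' s, x.1 s)
    have := α.norm_integrated_le_seminorm x (CovariantRep.ofRepresentation hG π hπ)
    rw [CovariantRep.integrated_eq hG] at this
    exact h.trans this

open Classical in
/-- The function supported at `1` with value `a` there. -/
noncomputable def single (a : A) : α.L :=
  ⟨Pi.single 1 a, fun g => by
    by_cases h : g = 1
    · subst h; rw [α.D_one]; trivial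
    · rw [Pi.single_eq_of_ne h]; exact (α.D g).zero_mem,
    summable_of_ne_finset_zero (s := {1}) fun g hg => by
      rw [Pi.single_eq_of_ne (by simpa using hg), norm_zero]⟩

theorem tsum_single (a : A) : ∑' s, (α.single a).1 s = a := by
  classical
  refine (tsum_eq_single 1 fun s hs => ?_).trans (?_ : (α.single a).1 1 = a)
  · simp only [single]; exact Pi.single_eq_of_ne hs _
  · simp only [single]; exact Pi.single_eq_same _ _

variable {α}

/-- The canonical embedding of `A` into the crossed product by a semilattice. -/
noncomputable def embed (hG : IsSemilattice G) : A →⋆ₙₐ[ℂ] α.CrossedProduct where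
  toFun a := CrossedProduct.ι α (α.Φ (α.single a))
  map_smul' c a := by
    rw [← _root_.map_smul, ← _root_.map_smul]
    congr 1
    -- Equality in `L / N` is tested on integrated forms, and these depend only on total sums. Each
    -- algebraic identity for the embedding thus reduces to the same identity for `r.π`.
    refine α.Φ_eq_iff'.mpr fun r => ?_
    simp only [r.integrated_smul, r.integrated_eq hG, tsum_single, _root_.map_smul]
    rfl
  map_zero' := by
    rw [← map_zero (CrossedProduct.ι α), ← map_zero α.Φ]
    congr 1
    refine α.Φ_eq_iff'.mpr fun r => ?_
    rw [← zero_smul ℂ (0 : α.L), r.integrated_smul, zero_smul, r.integrated_eq hG, tsum_single,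
      map_zero]
  map_add' a b := by
    rw [← _root_.map_add, ← _root_.map_add]
    congr 1
    refine α.Φ_eq_iff'.mpr fun r => ?_
    simp only [r.integrated_add, r.integrated_eq hG, tsum_single, _root_.map_add]
  map_mul' a b := by
    rw [← CrossedProduct.ι_mul, ← Φ_mul]
    congr 1
    refine α.Φ_eq_iff'.mpr fun r => ?_
    simp only [r.integrated_mul, r.integrated_eq hG, tsum_single, _root_.map_mul]
  map_star' a := by
    rw [← CrossedProduct.ι_star, ← Φ_star]
    congr 1
    refine α.Φ_eq_iff'.mpr fun r => ?_
    simp only [r.integrated_star, r.integrated_eq hG, tsum_single]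
    exact StarHomClass.map_star r.π a

theorem norm_embed (hG : IsSemilattice G) (a : A) : ‖embed (α := α) hG a‖ = ‖a‖ := by
  show ‖CrossedProduct.ι α (α.Φ (α.single a))‖ = _
  refine ((CrossedProduct.ι α).norm_map _).trans ((α.norm_Φ _).trans ?_)
  rw [α.seminorm_eq hG, tsum_single]

/-- Both sides come from functions with the same total sum, so they agree modulo `N`. Consequently
the range of the embedding contains all of `L / N`. -/
theorem embed_tsum (hG : IsSemilattice G) (x : α.L) :
    embed hG (∑' s, x.1 s) = CrossedProduct.ι α (α.Φ x) := by
  show CrossedProduct.ι α (α.Φ (α.single _)) = _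
  congr 1
  refine α.Φ_eq_iff'.mpr fun r => ?_
  simp only [r.integrated_eq hG, tsum_single]

/-- An isometry from a complete space has closed range, and this range contains the dense image of
`L / N`. -/
theorem embed_bijective (hG : IsSemilattice G) : Function.Bijective (embed (α := α) hG) := by
  have hi : Isometry (embed (α := α) hG) :=
    AddMonoidHomClass.isometry_of_norm _ (norm_embed hG)
  refine ⟨hi.injective, fun b => ?_⟩
  refine CrossedProduct.induction_on b hi.isClosedEmbedding.isClosed_range fun c => ?_
  obtain ⟨x, rfl⟩ := α.Φ_surjective c
  exact ⟨_, embed_tsum hG x⟩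

end PartialAction

end PartialCrossedProduct

theorem corollary4p6 {G : Type*} [PartialCrossedProduct.UnitalInverseSemigroup G]
    {A : Type*} [NonUnitalCStarAlgebra A]
    (hG : PartialCrossedProduct.IsSemilattice G)
    (β : PartialCrossedProduct.PartialAction G A) :
    Nonempty (β.CrossedProduct ≃⋆ₐ[ℂ] A) :=
  ⟨(StarAlgEquiv.ofBijective _
    (PartialCrossedProduct.PartialAction.embed_bijective (α := β) hG)).symm⟩
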